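/- Let $K$ be a field and $S=K[x_1,\ldots,x_n]$ the standard graded polynomial ring. Let $I\subseteq S$ be an ideal generated by elements $f_1,\ldots,f_m$ that are homogeneous of the same degree $d$. Let $R(I)=\bigoplus_{j\ge 0}I^jt^j\subseteq S[t]$ be the Rees ring of $I$, let $T=K[x_1,\ldots,x_n,y_1,\ldots,y_m]$, and let $P$ be the kernel of the surjective homomorphism of $K$-algebras $\varphi\colon T\to R(I)$ with $\varphi(x_i)=x_i$ and $\varphi(y_j)=f_jt$, so that $R(I)\cong T/P$. For a polynomial $g\in T$ let $\deg_x(g)$ be the maximum, over the monomials occurring in $g$, of the degree in the variables $x_1,\ldots,x_n$ (and $0$ if $g=0$). Suppose that for some term order $<$ on $T$ the ideal $P$ has a Gröbner basis $G$ with $\deg_x(g)\le 1$ for all $g\in G$. Then every power of $I$ has a linear resolution; that is, for every $k\ge 0$ the minimal graded free $S$-resolution of $I^k$ has the form $$\cdots\to S(-kd-2)^{\beta_2}\to S(-kd-1)^{\beta_1}\to S(-kd)^{\beta_0}\to I^k\to 0$$ with integers $\beta_i\ge 0$ depending on $k$. -/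

import Mathlib

/-- A graded free resolution
`⋯ → F₂ → F₁ → F₀ → I → 0`, with `F_i = ⨁_a S(-shift i a)` of finite rank, of an ideal `I` of the
standard graded polynomial ring `S = K[x₁, …, xₙ]`. The differentials and the augmentation are
given by matrices with respect to homogeneous bases. -/
structure GradedFreeResolution {K : Type*} [Field K] {n : ℕ}
    (I : Ideal (MvPolynomial (Fin n) K)) where
  /-- the rank of `F_i` -/
  rank : ℕ → ℕ
  /-- the degrees of the basis elements of `F_i` -/
  shift : ∀ i, Fin (rank i) → ℕ
  /-- the images in `I` of the basis elements of `F_0` -/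
  aug : Fin (rank 0) → MvPolynomial (Fin n) K
  /-- the matrix of `F_{i+1} → F_i` -/
  diff : ∀ i, Matrix (Fin (rank i)) (Fin (rank (i + 1))) (MvPolynomial (Fin n) K)
  /-- the augmentation is homogeneous of degree `0` -/
  aug_homogeneous : ∀ a, (aug a).IsHomogeneous (shift 0 a)
  /-- the differentials are homogeneous of degree `0`: the entry in row `a` and column `b` is
  homogeneous of degree `shift (i + 1) b - shift i a` (hence zero if this number is negative) -/
  diff_homogeneous : ∀ i a b, ∀ s ∈ (diff i a b).support,
    s.degree + shift i a = shift (i + 1) b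
  /-- `F_0 → I` is well defined and surjective -/
  span_aug : Ideal.span (Set.range aug) = I
  /-- exactness at `F_0` -/
  exact_zero : ∀ v : Fin (rank 0) → MvPolynomial (Fin n) K,
    ∑ a, v a * aug a = 0 ↔ ∃ w, (diff 0).mulVec w = v
  /-- exactness at `F_{i+1}` -/
  exact_succ : ∀ i, ∀ v : Fin (rank (i + 1)) → MvPolynomial (Fin n) K,
    (diff i).mulVec v = 0 ↔ ∃ w, (diff (i + 1)).mulVec w = v

/-- A graded free resolution is minimal if all entries of its differentials lie in the graded
maximal ideal `(x₁, …, xₙ)`. -/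
def GradedFreeResolution.IsMinimal {K : Type*} [Field K] {n : ℕ}
    {I : Ideal (MvPolynomial (Fin n) K)} (F : GradedFreeResolution I) : Prop :=
  ∀ i a b, MvPolynomial.constantCoeff (F.diff i a b) = 0

/-- `I` has a `d`-linear resolution: its minimal graded free resolution has the form
`⋯ → S(-d-2)^{β₂} → S(-d-1)^{β₁} → S(-d)^{β₀} → I → 0`. (The minimal graded free resolution is
unique up to isomorphism, and it has finite length by Hilbert's syzygy theorem.) -/
def HasLinearResolution {K : Type*} [Field K] {n : ℕ}
    (I : Ideal (MvPolynomial (Fin n) K)) (d : ℕ) : Prop :=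
  ∃ F : GradedFreeResolution I, F.IsMinimal ∧ ∀ i a, F.shift i a = d + i

/-- The homomorphism of `K`-algebras `φ : T = K[x₁, …, xₙ, y₁, …, yₘ] → R(I) = ⨁ I^j t^j ⊆ S[t]`
with `φ(x_i) = x_i` and `φ(y_j) = f_j t`, for elements `f_1, …, f_m` of `I`. -/
noncomputable def reesMap {K : Type*} [Field K] {n m : ℕ}
    (I : Ideal (MvPolynomial (Fin n) K)) (f : Fin m → I) :
    MvPolynomial (Fin n ⊕ Fin m) K →ₐ[K] reesAlgebra I :=
  MvPolynomial.aeval (Sum.elim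
    (fun i => algebraMap (MvPolynomial (Fin n) K) (reesAlgebra I) (MvPolynomial.X i))
    (fun j => ⟨Polynomial.monomial 1 (f j : MvPolynomial (Fin n) K),
      reesAlgebra.monomial_mem.mpr (by rw [pow_one]; exact (f j).2)⟩))

/-- The defining ideal `P = ker φ` of the Rees ring, so that `R(I) = T/P` if the `f_j`
generate `I`. -/
noncomputable def reesIdeal {K : Type*} [Field K] {n m : ℕ}
    (I : Ideal (MvPolynomial (Fin n) K)) (f : Fin m → I) :
    Ideal (MvPolynomial (Fin n ⊕ Fin m) K) :=
  RingHom.ker (reesMap I f)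

/-- If the `f_j` generate `I`, then `φ : T → R(I)` is surjective. -/
theorem reesMap_surjective {K : Type*} [Field K] {n m : ℕ}
    (I : Ideal (MvPolynomial (Fin n) K)) (f : Fin m → I)
    (hI : Ideal.span (Set.range fun j => (f j : MvPolynomial (Fin n) K)) = I) :
    Function.Surjective (reesMap I f) := by
  set ψ := ((reesAlgebra I).val.restrictScalars K).comp (reesMap I f) with hψ
  have hC : ∀ p : MvPolynomial (Fin n) K, Polynomial.C p ∈ ψ.range := by
    intro p
    rw [AlgHom.mem_range]
    refine ⟨MvPolynomial.rename Sum.inl p, ?_⟩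
    induction p using MvPolynomial.induction_on with
    | C a => rw [MvPolynomial.rename_C]; exact ψ.commutes a
    | add p q hp hq => rw [map_add, map_add, map_add, hp, hq]
    | mul_X p i hp =>
      rw [map_mul, map_mul, map_mul, hp, MvPolynomial.rename_X]
      congr 1
      simp only [hψ, reesMap, AlgHom.comp_apply, MvPolynomial.aeval_X, Sum.elim_inl]
      rfl
  have hy : ∀ j, Polynomial.monomial 1 (f j : MvPolynomial (Fin n) K) ∈ ψ.range := by
    intro j
    rw [AlgHom.mem_range]
    refine ⟨MvPolynomial.X (Sum.inr j), ?_⟩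
    simp only [hψ, reesMap, AlgHom.comp_apply, MvPolynomial.aeval_X, Sum.elim_inr]
    rfl
  have hm : ∀ r ∈ I, Polynomial.monomial 1 r ∈ ψ.range := by
    intro r hr
    rw [← hI] at hr
    induction hr using Submodule.span_induction with
    | mem x hx => obtain ⟨j, rfl⟩ := hx; exact hy j
    | zero => rw [map_zero]; exact zero_mem _
    | add x y _ _ hx hy => rw [map_add]; exact add_mem hx hy
    | smul a x _ hx =>
      rw [smul_eq_mul, ← Polynomial.C_mul_monomial]
      exact mul_mem (hC a) hx
  have hz : ∀ q ∈ reesAlgebra I, q ∈ ψ.range := by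
    intro q hq
    rw [← adjoin_monomial_eq_reesAlgebra] at hq
    induction hq using Algebra.adjoin_induction with
    | mem x hx => obtain ⟨r, hr, rfl⟩ := hx; exact hm r hr
    | algebraMap r => exact hC r
    | add x y _ _ hx hy => exact add_mem hx hy
    | mul x y _ _ hx hy => exact mul_mem hx hy
  intro z
  obtain ⟨t, ht⟩ := (AlgHom.mem_range ψ).mp (hz z z.2)
  exact ⟨t, Subtype.ext ht⟩

/-- A Gröbner basis of the ideal `P` with respect to a term order: a finite subset of `P` whose
leading terms generate the initial ideal of `P`. (The leading term of `0` is `0`.) -/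
def IsGroebnerBasis {K σ : Type*} [Field K] (ord : MonomialOrder σ)
    (P : Ideal (MvPolynomial σ K)) (G : Set (MvPolynomial σ K)) : Prop :=
  G.Finite ∧ G ⊆ (P : Set (MvPolynomial σ K)) ∧
    Ideal.span (ord.leadingTerm '' G) =
      Ideal.span (ord.leadingTerm '' (P : Set (MvPolynomial σ K)))

/-- The `x`-degree of a polynomial in `K[x₁, …, xₙ, y₁, …, yₘ]`: the maximum over its monomials of
the degree in the variables `x₁, …, xₙ` (and `0` for the zero polynomial). -/
def xDegree {K : Type*} [Field K] {n m : ℕ} (p : MvPolynomial (Fin n ⊕ Fin m) K) : ℕ :=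
  p.support.sup fun s => ∑ i, s (Sum.inl i)

/-!
Every power `I^k` is resolved by iterating Schreyer's syzygy algorithm, starting from the part of
`K[x, y]` of `y`-degree `k`.

That part is the free `S`-module with basis the monomials `y^a`, `|a| = k`, and modulo `P` it is
`I^k`, with `y^a ↦ f^a`. The leading monomials of the Gröbner basis have `x`-degree at most one, so
the initial ideal of `P` meets `S y^a` in `J_a y^a`, where `J_a` is either the unit ideal or
generated by variables. The `y^a` with `J_a` the unit ideal can be discarded
(`span_genPow_eq_pow`), and since all `f_j` have the same degree `P` is bihomogeneous, so the
relations among the remaining `f^a` have a Gröbner basis consisting of vectors with linear entries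
(`isLinearGroebner_ker`).

This situation reproduces itself (`HasLinearGroebner.exists_matrix`). Let `N ⊆ S^r` have a Gröbner
basis of linear vectors `g_{a,i}` with leading monomials `x_i e_a`, for `i` in a set `V a`. The
syzygies of the `g_{a,i}` come from the S-pairs `x_j g_{a,i} - x_i g_{a,j}` with `j < i` in `V a`.
Division expresses such an S-pair, which has quadratic entries, through the `g` with linear
coefficients. Hence in Schreyer's order the module of syzygies again has a Gröbner basis of linear
vectors, with leading monomials `x_j ε_{a,i}`. Iterating, all matrices of the resolution have linear
entries; such a resolution is minimal and its shifts are `kd + i`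
(`hasLinearResolution_of_hasLinearGroebner`).

Monomial orders on the free modules `S^r` are encoded by an injection `ω` of the set of monomials
into a well-ordered type. Gröbner bases of submodules are not defined as such: what is used is that
each `x_i e_a` with `i ∈ V a` is the leading monomial of an element of `N` and that no nonzero
element of `N` is supported on the monomials divisible by none of these.
-/

/-! ### Linear Gröbner bases of submodules of a free module -/

section LinearGroebner

open MvPolynomial

variable {K : Type*} [Field K] {n : ℕ} {ι κ W : Type*}

/-- The monomial `x^u e_a` of the free module `S^ι`. -/
noncomputable def monoVec [DecidableEq ι] (a : ι) (u : Fin n →₀ ℕ) :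
    ι → MvPolynomial (Fin n) K :=
  Pi.single a (monomial u 1)

/-- The `K`-span of the monomials `x^u e_a` of `S^ι` with `deg u = e` and with position `ω a u`
in the set `A`. Here `ω` embeds the monomials of `S^ι` into an ordered type, which is how monomial
orders on free modules are encoded. -/
noncomputable def monoSpan (K : Type*) [Field K] [DecidableEq ι] (ω : ι → (Fin n →₀ ℕ) → W)
    (e : ℕ) (A : Set W) :
    Submodule K (ι → MvPolynomial (Fin n) K) :=
  Submodule.span K {v | ∃ a u, u.degree = e ∧ ω a u ∈ A ∧ v = monoVec a u}

/-- The vectors of `S^ι` supported on monomials `x^u e_a` for which no variable in `V a` divides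
`x^u`: the span of the standard monomials for the initial module `⨁ (V a) e_a`. -/
noncomputable def standardSpan (K : Type*) [Field K] (V : ι → Set (Fin n)) :
    Submodule K (ι → MvPolynomial (Fin n) K) where
  carrier := {v | ∀ a u, (∃ i ∈ V a, u i ≠ 0) → coeff u (v a) = 0}
  add_mem' hv hw a u h := by simp [hv a u h, hw a u h]
  zero_mem' a u _ := by simp
  smul_mem' c v hv a u h := by simp [hv a u h]

/-- The submodule `N` of `S^ι` has, for the monomial order `ω`, the initial module `⨁ J_a e_a`,
where `J_a` is generated by the variables in `V a`, and a Gröbner basis consisting of vectors with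
linear entries. The equality of initial modules is expressed by `eq_zero_of_mem_standard`: no
nonzero element of `N` is supported on standard monomials. -/
structure IsLinearGroebner [DecidableEq ι] [LinearOrder W] (ω : ι → (Fin n →₀ ℕ) → W)
    (V : ι → Set (Fin n)) (N : Submodule (MvPolynomial (Fin n) K) (ι → MvPolynomial (Fin n) K)) :
    Prop where
  inj : ∀ a b u v, ω a u = ω b v → a = b ∧ u = v
  add_lt : ∀ a b u v w, ω a u < ω b v → ω a (u + w) < ω b (v + w)
  exists_lead : ∀ a, ∀ i ∈ V a, ∃ h ∈ monoSpan K ω 1 (Set.Iio (ω a (Finsupp.single i 1))),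
    monoVec a (Finsupp.single i 1) + h ∈ N
  eq_zero_of_mem_standard : ∀ v ∈ N, v ∈ standardSpan K V → v = 0

section

variable [DecidableEq ι] [DecidableEq κ]

theorem monomial_smul_monoVec (a : ι) (u w : Fin n →₀ ℕ) :
    (monomial w (1 : K)) • (monoVec a u : ι → MvPolynomial (Fin n) K) = monoVec a (u + w) := by
  rw [monoVec, monoVec, ← Pi.single_smul, smul_eq_mul, monomial_mul, one_mul, add_comm]

theorem coeff_monoVec (a b : ι) (u v : Fin n →₀ ℕ) :
    coeff v ((monoVec a u : ι → MvPolynomial (Fin n) K) b) = if a = b ∧ u = v then 1 else 0 := by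
  classical
  rw [monoVec]
  by_cases h : a = b
  · subst h; simp [coeff_monomial]
  · rw [Pi.single_eq_of_ne (Ne.symm h)]; simp [h]

theorem monoVec_mem_monoSpan {ω : ι → (Fin n →₀ ℕ) → W} {A : Set W} (a : ι) (u : Fin n →₀ ℕ)
    (h : ω a u ∈ A) : monoVec a u ∈ monoSpan K ω u.degree A :=
  Submodule.subset_span ⟨a, u, rfl, h, rfl⟩

theorem monoSpan_mono {ω : ι → (Fin n →₀ ℕ) → W} {e : ℕ} {A : Set W} {W' : Type*}
    {ω' : ι → (Fin n →₀ ℕ) → W'} {B : Set W'} (h : ∀ a u, ω a u ∈ A → ω' a u ∈ B) :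
    monoSpan K ω e A ≤ monoSpan K ω' e B := by
  apply Submodule.span_mono
  rintro v ⟨a, u, he, hA, rfl⟩
  exact ⟨a, u, he, h a u hA, rfl⟩

theorem monomial_smul_mem_monoSpan {ω : ι → (Fin n →₀ ℕ) → W} {e : ℕ} {A B : Set W}
    (w : Fin n →₀ ℕ) (hAB : ∀ a u, ω a u ∈ A → ω a (u + w) ∈ B)
    {h : ι → MvPolynomial (Fin n) K} (hh : h ∈ monoSpan K ω e A) :
    (monomial w (1 : K)) • h ∈ monoSpan K ω (e + w.degree) B := by
  induction hh using Submodule.span_induction with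
  | mem x hx =>
    obtain ⟨a, u, rfl, hA, rfl⟩ := hx
    rw [monomial_smul_monoVec, ← map_add]
    exact monoVec_mem_monoSpan _ _ (hAB _ _ hA)
  | zero => rw [smul_zero]; exact zero_mem _
  | add x y _ _ hx hy => rw [smul_add]; exact add_mem hx hy
  | smul c x _ hx => rw [smul_comm]; exact Submodule.smul_mem _ _ hx

theorem coeff_eq_zero_of_mem_monoSpan {ω : ι → (Fin n →₀ ℕ) → W} {e : ℕ} {A : Set W}
    {h : ι → MvPolynomial (Fin n) K} (hh : h ∈ monoSpan K ω e A) (a : ι) (u : Fin n →₀ ℕ)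
    (hu : ω a u ∉ A) : coeff u (h a) = 0 := by
  induction hh using Submodule.span_induction with
  | mem x hx =>
    obtain ⟨b, v, rfl, hA, rfl⟩ := hx
    rw [coeff_monoVec, if_neg]
    rintro ⟨rfl, rfl⟩
    exact hu hA
  | zero => simp
  | add x y _ _ hx hy => simp [hx, hy]
  | smul c x _ hx => simp [hx]

theorem isHomogeneous_of_mem_monoSpan {ω : ι → (Fin n →₀ ℕ) → W} {e : ℕ} {A : Set W}
    {h : ι → MvPolynomial (Fin n) K} (hh : h ∈ monoSpan K ω e A) (a : ι) :
    (h a).IsHomogeneous e := by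
  induction hh using Submodule.span_induction with
  | mem x hx =>
    obtain ⟨b, v, rfl, hA, rfl⟩ := hx
    by_cases hab : a = b
    · subst hab
      rw [monoVec, Pi.single_eq_same]
      exact isHomogeneous_monomial _ rfl
    · rw [monoVec, Pi.single_eq_of_ne hab]
      exact isHomogeneous_zero _ _ _
  | zero => exact isHomogeneous_zero _ _ _
  | add x y _ _ hx hy => exact hx.add hy
  | smul c x _ hx =>
    rw [Pi.smul_apply, smul_eq_C_mul]
    simpa using (isHomogeneous_C _ c).mul hx

theorem eq_sum_monoVec [Fintype ι] (v : ι → MvPolynomial (Fin n) K) :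
    v = ∑ a, ∑ u ∈ (v a).support, coeff u (v a) • (monoVec a u : ι → MvPolynomial (Fin n) K) := by
  have h : ∀ a, ∑ u ∈ (v a).support, coeff u (v a) • (monoVec a u : ι → MvPolynomial (Fin n) K)
      = Pi.single a (v a) := by
    intro a
    conv_rhs => rw [(v a).as_sum]
    rw [← LinearMap.single_apply (R := K) (φ := fun _ => MvPolynomial (Fin n) K), map_sum]
    refine Finset.sum_congr rfl fun u _ => ?_
    rw [LinearMap.single_apply, monoVec, ← Pi.single_smul, smul_monomial, smul_eq_mul, mul_one]
  simp_rw [h]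
  exact (Finset.univ_sum_single v).symm

/-- Division by the linear Gröbner basis elements `g c`, with leading monomials
`x_{(p c).2} e_{(p c).1}`: it lowers the degree of the coefficients by one, and no term
that is used exceeds the largest term of the vector divided. -/
theorem monoSpan_succ_le [LinearOrder W] [WellFoundedLT W] [Fintype κ]
    {ω : ι → (Fin n →₀ ℕ) → W} {V : ι → Set (Fin n)}
    (hadd : ∀ a b u v w, ω a u < ω b v → ω a (u + w) < ω b (v + w))
    (p : κ → ι × Fin n) (hp : ∀ a, ∀ i ∈ V a, ∃ c, p c = (a, i))
    (h : κ → ι → MvPolynomial (Fin n) K)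
    (hh : ∀ c, h c ∈ monoSpan K ω 1 (Set.Iio (ω (p c).1 (Finsupp.single (p c).2 1))))
    (D : (κ → MvPolynomial (Fin n) K) →ₗ[MvPolynomial (Fin n) K] (ι → MvPolynomial (Fin n) K))
    (hD : ∀ c u, D (monoVec c u) =
      monomial u (1 : K) • (monoVec (p c).1 (Finsupp.single (p c).2 1) + h c))
    (e : ℕ) (A : Set W) (hA : IsLowerSet A) :
    monoSpan K ω (e + 1) A ≤
      (monoSpan K (fun c u => ω (p c).1 (Finsupp.single (p c).2 1 + u)) e A).map
        (D.restrictScalars K) ⊔ standardSpan K V := by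
  have key : ∀ t : W, ∀ a u, ω a u = t → u.degree = e + 1 → t ∈ A →
      (monoVec a u : ι → MvPolynomial (Fin n) K) ∈
      (monoSpan K (fun c u => ω (p c).1 (Finsupp.single (p c).2 1 + u)) e A).map
        (D.restrictScalars K) ⊔ standardSpan K V := by
    intro t
    induction t using WellFoundedLT.induction with
    | ind t ih =>
    rintro a u rfl hu hmem
    by_cases hstd : ∃ i ∈ V a, u i ≠ 0
    · obtain ⟨i, hi, hui⟩ := hstd
      obtain ⟨c, hc⟩ := hp a i hi
      obtain ⟨w, rfl⟩ : ∃ w, u = Finsupp.single i 1 + w :=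
        ⟨u - Finsupp.single i 1, by
          rw [add_tsub_cancel_of_le]
          exact Finsupp.single_le_iff.mpr (Nat.one_le_iff_ne_zero.mpr hui)⟩
      have hw : w.degree = e := by
        rw [map_add, Finsupp.degree_single] at hu; omega
      have hDc := hD c w
      rw [smul_add, monomial_smul_monoVec] at hDc
      have hhc := hh c
      simp only [hc] at hDc hhc
      rw [← sub_eq_iff_eq_add] at hDc
      rw [← hDc]
      refine sub_mem (Submodule.mem_sup_left ⟨_, ?_, rfl⟩) ?_
      · rw [← hw]
        apply monoVec_mem_monoSpan
        simpa only [hc] using hmem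
      · have h2 := monomial_smul_mem_monoSpan (B := Set.Iio (ω a (Finsupp.single i 1 + w))) w
          (fun b v hb => hadd _ _ _ _ _ hb) hhc
        refine (Submodule.span_le.mpr ?_) h2
        rintro v ⟨b, v, hv, hlt, rfl⟩
        exact ih _ hlt b v rfl (by rw [hv]; omega) (hA (le_of_lt hlt) hmem)
    · refine Submodule.mem_sup_right fun b v hbv => ?_
      rw [coeff_monoVec, if_neg]
      rintro ⟨rfl, rfl⟩
      exact hstd hbv
  refine Submodule.span_le.mpr ?_
  rintro v ⟨a, u, hu, hmem, rfl⟩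
  exact key _ a u rfl hu hmem

end

/-! ### The syzygy step -/

/-- Existence of a monomial order, with values in a well-ordered type, for which `N` has a linear
Gröbner basis and an initial module given by variables. -/
def HasLinearGroebner.{w} {K : Type*} [Field K] {n r : ℕ}
    (N : Submodule (MvPolynomial (Fin n) K) (Fin r → MvPolynomial (Fin n) K)) : Prop :=
  ∃ (W : Type w) (_ : LinearOrder W) (_ : WellFoundedLT W) (ω : Fin r → (Fin n →₀ ℕ) → W)
    (V : Fin r → Set (Fin n)), IsLinearGroebner ω V N

/-- The step of Schreyer's algorithm. The Gröbner basis of `N` is indexed by the pairs `(a, i)`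
with `i ∈ V a`; ordering the monomials upstairs by their leading monomials, with ties broken by
`i`, the syzygies have the leading monomials `x_j ε_{a,i}` with `j ∈ V a` and `j < i`. -/
theorem HasLinearGroebner.exists_matrix.{w} {r : ℕ}
    {N : Submodule (MvPolynomial (Fin n) K) (Fin r → MvPolynomial (Fin n) K)}
    (hN : HasLinearGroebner.{w} N) :
    ∃ (s : ℕ) (D : Matrix (Fin r) (Fin s) (MvPolynomial (Fin n) K)),
      (∀ a b, (D a b).IsHomogeneous 1) ∧ LinearMap.range D.mulVecLin = N ∧
      HasLinearGroebner.{w} (LinearMap.ker D.mulVecLin) := by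
  classical
  obtain ⟨W, _, _, ω, V, H⟩ := hN
  obtain ⟨s, ⟨q⟩⟩ := Finite.exists_equiv_fin {c : Fin r × Fin n // c.2 ∈ V c.1}
  set p : Fin s → Fin r × Fin n := fun c => (q.symm c).1 with hpdef
  have hpV : ∀ c, (p c).2 ∈ V (p c).1 := fun c => (q.symm c).2
  have hp_inj : Function.Injective p := Subtype.val_injective.comp q.symm.injective
  have hp : ∀ a, ∀ i ∈ V a, ∃ c, p c = (a, i) := fun a i hi => ⟨q ⟨(a, i), hi⟩, by simp [hpdef]⟩
  choose h hh hhN using fun c => H.exists_lead (p c).1 (p c).2 (hpV c)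
  set D : Matrix (Fin r) (Fin s) (MvPolynomial (Fin n) K) :=
    Matrix.of fun a c => monoVec (p c).1 (Finsupp.single (p c).2 1) a + h c a with hDdef
  have hD : ∀ c u, D.mulVecLin (monoVec c u) =
      monomial u (1 : K) • (monoVec (p c).1 (Finsupp.single (p c).2 1) + h c) := by
    intro c u
    ext1 a
    rw [Matrix.mulVecLin_apply, monoVec, Matrix.mulVec_single]
    simp [hDdef, mul_comm, mul_add]
  have hDN : ∀ v, D.mulVecLin v ∈ N := by
    intro v
    rw [eq_sum_monoVec v]
    simp_rw [map_sum]
    refine sum_mem fun c _ => sum_mem fun u _ => ?_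
    rw [← algebraMap_smul (MvPolynomial (Fin n) K), map_smul, hD]
    exact N.smul_mem _ (N.smul_mem _ (hhN c))
  have hdiv := monoSpan_succ_le H.add_lt p hp h hh D.mulVecLin hD
  have hmemN : ∀ {v x y}, v ∈ N → x + y = v → x ∈ N → y ∈ standardSpan K V → x = v := by
    intro v x y hv hxy hx hy
    have : y ∈ N := by rw [← sub_eq_of_eq_add' hxy.symm]; exact sub_mem hv hx
    rw [H.eq_zero_of_mem_standard y this hy, add_zero] at hxy
    exact hxy
  refine ⟨s, D, ?_, le_antisymm ?_ ?_, ?_⟩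
  · intro a c
    refine IsHomogeneous.add (R := K) (φ := monoVec (p c).1 _ a) ?_
      (isHomogeneous_of_mem_monoSpan (hh c) a)
    have := monoVec_mem_monoSpan (K := K) (ω := ω) (A := Set.univ) (p c).1
      (Finsupp.single (p c).2 1) trivial
    rw [Finsupp.degree_single] at this
    exact isHomogeneous_of_mem_monoSpan this a
  · rintro _ ⟨v, rfl⟩
    exact hDN v
  · intro v hv
    have hall : ∀ v, v ∈ (LinearMap.range D.mulVecLin).restrictScalars K ⊔ standardSpan K V := by
      intro v
      rw [eq_sum_monoVec v]
      refine sum_mem fun a _ => sum_mem fun u _ => Submodule.smul_mem _ _ ?_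
      rcases Nat.eq_zero_or_eq_succ_pred u.degree with h0 | h1
      · rw [Finsupp.degree_eq_zero_iff] at h0
        subst h0
        refine Submodule.mem_sup_right fun b v hbv => ?_
        rw [coeff_monoVec, if_neg]
        rintro ⟨rfl, rfl⟩
        simp at hbv
      · have := hdiv (u.degree - 1) Set.univ (fun _ _ _ _ => trivial)
          (show monoVec a u ∈ _ by
            convert monoVec_mem_monoSpan (K := K) (ω := ω) a u (Set.mem_univ _) using 2
            exact h1.symm)
        obtain ⟨_, ⟨x, _, rfl⟩, y, hy, hxy⟩ := Submodule.mem_sup.mp this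
        exact Submodule.mem_sup.mpr ⟨_, ⟨x, rfl⟩, y, hy, hxy⟩
    obtain ⟨_, ⟨w, rfl⟩, y, hy, hxy⟩ := Submodule.mem_sup.mp (hall v)
    exact ⟨w, hmemN hv hxy (hDN w) hy⟩
  · refine ⟨W ×ₗ Fin n, inferInstance, inferInstance,
      fun c u => toLex (ω (p c).1 (Finsupp.single (p c).2 1 + u), (p c).2),
      fun c => {j | j ∈ V (p c).1 ∧ j < (p c).2}, ?_, ?_, ?_, ?_⟩
    · intro c c' u v huv
      obtain ⟨h1, h2⟩ := Prod.ext_iff.mp (toLex.injective huv)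
      obtain ⟨h3, h4⟩ := H.inj _ _ _ _ h1
      have h2 : (p c).2 = (p c').2 := h2
      have hcc := hp_inj (Prod.ext h3 h2)
      subst hcc
      exact ⟨rfl, add_left_cancel h4⟩
    · intro c c' u v w hlt
      rw [Prod.Lex.toLex_lt_toLex] at hlt ⊢
      rcases hlt with hlt | ⟨heq, hlt⟩
      · left
        simpa only [add_assoc] using H.add_lt _ _ _ _ w hlt
      · right
        obtain ⟨h3, h4⟩ := H.inj _ _ _ _ heq
        refine ⟨?_, hlt⟩
        simp only [← add_assoc]
        exact congrArg₂ (fun a u => ω a (u + w)) h3 h4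
    · rintro c j ⟨hj, hji⟩
      obtain ⟨c', hc'⟩ := hp _ j hj
      set a := (p c).1 with ha
      set i := (p c).2 with hi
      -- The S-vector of the basis elements with leading monomials `x_i e_a` and `x_j e_a`.
      set sv := monomial (Finsupp.single j 1) (1 : K) • h c -
        monomial (Finsupp.single i 1) (1 : K) • h c' with hsv
      have hsv_eq : D.mulVecLin (monoVec c (Finsupp.single j 1) - monoVec c' (Finsupp.single i 1))
          = sv := by
        rw [map_sub, hD, hD, smul_add, smul_add, monomial_smul_monoVec, monomial_smul_monoVec]
        simp only [hc', ← ha, ← hi, hsv]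
        rw [add_comm (Finsupp.single j 1)]
        abel
      have hsv_mem : sv ∈ monoSpan K ω (1 + 1)
          (Set.Iio (ω a (Finsupp.single i 1 + Finsupp.single j 1))) := by
        have h1 := monomial_smul_mem_monoSpan
          (B := Set.Iio (ω a (Finsupp.single i 1 + Finsupp.single j 1))) (Finsupp.single j 1)
          (fun b v hb => H.add_lt _ _ _ _ _ hb) (hh c)
        have h2' := hh c'
        simp only [hc'] at h2'
        have h2 := monomial_smul_mem_monoSpan
          (B := Set.Iio (ω a (Finsupp.single j 1 + Finsupp.single i 1))) (Finsupp.single i 1)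
          (fun b v hb => H.add_lt _ _ _ _ _ hb) h2'
        rw [add_comm (Finsupp.single j 1)] at h2
        rw [Finsupp.degree_single] at h1 h2
        exact sub_mem h1 h2
      obtain ⟨_, ⟨w, hw, rfl⟩, y, hy, hxy⟩ := Submodule.mem_sup.mp
        (hdiv 1 _ (isLowerSet_Iio _) hsv_mem)
      have hw_eq : D.mulVecLin w = sv := hmemN (hsv_eq ▸ hDN _) hxy (hDN w) hy
      refine ⟨- monoVec c' (Finsupp.single i 1) - w, sub_mem (neg_mem ?_) ?_, ?_⟩
      · have := monoVec_mem_monoSpan (K := K)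
          (ω := fun c u => toLex (ω (p c).1 (Finsupp.single (p c).2 1 + u), (p c).2))
          (A := Set.Iio (toLex (ω a (Finsupp.single i 1 + Finsupp.single j 1), i)))
          c' (Finsupp.single i 1) (by
            rw [Set.mem_Iio, Prod.Lex.toLex_lt_toLex]
            right
            rw [hc', add_comm (Finsupp.single j 1)]
            exact ⟨rfl, hji⟩)
        rwa [Finsupp.degree_single] at this
      · refine monoSpan_mono (fun b v hb => ?_) hw
        rw [Set.mem_Iio, Prod.Lex.toLex_lt_toLex]
        exact Or.inl hb
      · rw [LinearMap.mem_ker, ← add_sub_assoc, ← sub_eq_add_neg, map_sub, hsv_eq, hw_eq,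
          sub_self]
    · intro w hw hstd
      by_contra hne
      set T : Finset (Σ _ : Fin s, (Fin n →₀ ℕ)) := Finset.univ.sigma fun c => (w c).support with hT
      have hTne : T.Nonempty := by
        rw [Finset.nonempty_iff_ne_empty]
        intro hTe
        apply hne
        ext1 c
        rw [Pi.zero_apply, ← support_eq_empty, Finset.eq_empty_iff_forall_notMem]
        intro u hu
        have : (⟨c, u⟩ : Σ _ : Fin s, (Fin n →₀ ℕ)) ∈ T := by simpa [hT] using hu
        simp [hTe] at this
      obtain ⟨⟨c, u⟩, hcu, hmax⟩ :=
        T.exists_max_image (fun z => ω (p z.1).1 (Finsupp.single (p z.1).2 1 + z.2)) hTne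
      have hcu' : u ∈ (w c).support := by simpa [hT] using hcu
      have hmax' : ∀ c' u', u' ∈ (w c').support → ω (p c').1 (Finsupp.single (p c').2 1 + u') ≤
          ω (p c).1 (Finsupp.single (p c).2 1 + u) := fun c' u' hu' =>
        hmax ⟨c', u'⟩ (by simpa [hT] using hu')
      -- Only the term `x^u ε_c` of `w` contributes to the coefficient of the largest
      -- leading monomial in `D w`.
      have hcoeff : ∀ c' u', u' ∈ (w c').support →
          coeff (Finsupp.single (p c).2 1 + u) (D.mulVecLin (monoVec c' u') (p c).1) =
            if c' = c ∧ u' = u then 1 else 0 := by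
        intro c' u' hu'
        have hle := hmax' c' u' hu'
        have hzero : coeff (Finsupp.single (p c).2 1 + u)
            ((monomial u' (1 : K) • h c') (p c).1) = 0 :=
          coeff_eq_zero_of_mem_monoSpan (monomial_smul_mem_monoSpan
            (B := Set.Iio (ω (p c').1 (Finsupp.single (p c').2 1 + u'))) u'
            (fun b v hb => H.add_lt _ _ _ _ _ hb) (hh c')) _ _ (not_lt.mpr hle)
        rw [hD, smul_add, monomial_smul_monoVec, Pi.add_apply, coeff_add, hzero, add_zero,
          coeff_monoVec]
        refine if_congr ⟨?_, ?_⟩ rfl rfl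
        · rintro ⟨h1, h2⟩
          -- Both indices are the least variable of `V a` that divides the common monomial.
          have hmin : ∀ c₁ c₂ u₁ u₂, u₁ ∈ (w c₁).support → (p c₂).1 = (p c₁).1 →
              Finsupp.single (p c₂).2 1 + u₂ = Finsupp.single (p c₁).2 1 + u₁ →
              (p c₁).2 ≤ (p c₂).2 := by
            intro c₁ c₂ u₁ u₂ hu₁ ha hu
            by_contra! hlt
            refine mem_support_iff.mp hu₁ (hstd c₁ u₁ ⟨(p c₂).2, ⟨ha ▸ hpV c₂, hlt⟩, ?_⟩)
            have := DFunLike.congr_fun hu (p c₂).2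
            simp only [Finsupp.add_apply, Finsupp.single_eq_same,
              Finsupp.single_eq_of_ne hlt.ne] at this
            omega
          have h3 : (p c').2 = (p c).2 := le_antisymm
            (hmin c' c u' u hu' h1.symm h2.symm) (hmin c c' u u' hcu' h1 h2)
          have h4 := hp_inj (Prod.ext h1 h3)
          subst h4
          exact ⟨rfl, add_left_cancel h2⟩
        · rintro ⟨rfl, rfl⟩
          exact ⟨rfl, rfl⟩
      refine mem_support_iff.mp hcu' ?_
      have hDw : coeff (Finsupp.single (p c).2 1 + u) (D.mulVecLin w (p c).1) = 0 := by
        rw [LinearMap.mem_ker.mp hw]; simp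
      rw [eq_sum_monoVec w] at hDw
      simp_rw [map_sum, Finset.sum_apply, coeff_sum] at hDw
      rw [← hDw, Finset.sum_eq_single c, Finset.sum_eq_single u]
      · rw [← algebraMap_smul (MvPolynomial (Fin n) K), map_smul, algebraMap_smul, Pi.smul_apply,
          coeff_smul, hcoeff c u hcu', if_pos ⟨rfl, rfl⟩, smul_eq_mul, mul_one]
      · intro u' hu' hne'
        rw [← algebraMap_smul (MvPolynomial (Fin n) K), map_smul, algebraMap_smul, Pi.smul_apply,
          coeff_smul, hcoeff c u' hu', if_neg (fun h => hne' h.2), smul_zero]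
      · intro hu; exact absurd hcu' hu
      · intro c' _ hne'
        refine Finset.sum_eq_zero fun u' hu' => ?_
        rw [← algebraMap_smul (MvPolynomial (Fin n) K), map_smul, algebraMap_smul, Pi.smul_apply,
          coeff_smul, hcoeff c' u' hu', if_neg (fun h => hne' h.1), smul_zero]
      · intro hc; exact absurd (Finset.mem_univ c) hc

end LinearGroebner

/-! ### The linear resolution obtained by iterating the syzygy step -/

section Resolution

open MvPolynomial

variable {K : Type*} [Field K] {n : ℕ}

/-- Iterating Schreyer's step gives a resolution: generators of degree `e` whose relations have a
linear Gröbner basis resolve linearly. -/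
theorem hasLinearResolution_of_hasLinearGroebner.{w} {r e : ℕ}
    {I : Ideal (MvPolynomial (Fin n) K)} (g : Fin r → MvPolynomial (Fin n) K)
    (hg : ∀ a, (g a).IsHomogeneous e) (hI : Ideal.span (Set.range g) = I)
    (hN : HasLinearGroebner.{w} (LinearMap.ker
      (Fintype.linearCombination (MvPolynomial (Fin n) K) g))) :
    HasLinearResolution I e := by
  choose s D hD hrange hker using
    fun z : (Σ r, {N : Submodule (MvPolynomial (Fin n) K) (Fin r → MvPolynomial (Fin n) K) //
      HasLinearGroebner.{w} N}) => z.2.2.exists_matrix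
  -- The `i`-th term records the rank of `F_i` and the kernel of the map out of `F_i`.
  let M : ℕ → (Σ r, {N : Submodule (MvPolynomial (Fin n) K) (Fin r → MvPolynomial (Fin n) K) //
      HasLinearGroebner.{w} N}) :=
    fun i => Nat.rec ⟨r, _, hN⟩ (fun _ z => ⟨s z, _, hker z⟩) i
  have hhom : ∀ i a b, (D (M i) a b).IsHomogeneous 1 := fun i => hD (M i)
  refine ⟨⟨fun i => (M i).1, fun i _ => e + i, g, fun i => D (M i), hg, ?_, hI, ?_, ?_⟩, ?_,
    fun _ _ => rfl⟩
  · intro i a b u hu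
    have := hhom i a b (mem_support_iff.mp hu)
    have hw : u.degree = Finsupp.weight 1 u := DFunLike.congr_fun Finsupp.degree_eq_weight_one u
    rw [← hw] at this
    omega
  · intro v
    exact (SetLike.ext_iff.mp (hrange (M 0)) v).symm
  · intro i v
    exact (SetLike.ext_iff.mp (hrange (M (i + 1))) v).symm
  · intro i a b
    by_contra hne
    have := hhom i a b hne
    simp at this

end Resolution

/-! ### Standard monomials of an ideal -/

section Standard

open MvPolynomial

variable {K σ : Type*} [Field K] (ord : MonomialOrder σ) (P : Ideal (MvPolynomial σ K))

/-- The exponents of the monomials in the initial ideal of `P`. -/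
def initialExponents : Set (σ →₀ ℕ) :=
  {s | ∃ p ∈ P, p ≠ 0 ∧ ord.degree p = s}

variable {ord P}

theorem initialExponents_of_le {s t : σ →₀ ℕ} (hs : s ∈ initialExponents ord P) (hst : s ≤ t) :
    t ∈ initialExponents ord P := by
  obtain ⟨p, hp, hp0, rfl⟩ := hs
  have hm : (monomial (t - ord.degree p) (1 : K)) ≠ 0 := by simp
  refine ⟨monomial (t - ord.degree p) 1 * p, P.mul_mem_left _ hp, mul_ne_zero hm hp0, ?_⟩
  classical
  rw [ord.degree_mul hm hp0, ord.degree_monomial, if_neg one_ne_zero, tsub_add_cancel_of_le hst]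

theorem eq_zero_of_mem_restrictSupport_compl {p : MvPolynomial σ K} (hp : p ∈ P)
    (h : p ∈ restrictSupport K (initialExponents ord P)ᶜ) : p = 0 := by
  by_contra hne
  exact h (ord.degree_mem_support hne) ⟨p, hp, hne, rfl⟩

/-- Every leading monomial of `P` is divisible by one of a nonzero element of a Gröbner basis. -/
theorem IsGroebnerBasis.exists_degree_le {G : Set (MvPolynomial σ K)}
    (hG : IsGroebnerBasis ord P G) {s : σ →₀ ℕ} (hs : s ∈ initialExponents ord P) :
    ∃ g ∈ G, g ≠ 0 ∧ ord.degree g ≤ s := by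
  classical
  obtain ⟨-, -, hspan⟩ := hG
  obtain ⟨p, hp, hp0, rfl⟩ := hs
  have hmem : ord.leadingTerm p ∈ Ideal.span ((fun s => monomial s (1 : K)) ''
      {s | ∃ g ∈ G, g ≠ 0 ∧ ord.degree g = s}) := by
    have h1 : ord.leadingTerm p ∈ Ideal.span (ord.leadingTerm '' G) :=
      hspan ▸ Ideal.subset_span ⟨p, hp, rfl⟩
    refine Ideal.span_le.mpr ?_ h1
    rintro _ ⟨g, hg, rfl⟩
    by_cases hg0 : g = 0
    · simp [hg0, MonomialOrder.leadingTerm]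
    · have : ord.leadingTerm g = C (ord.leadingCoeff g) * monomial (ord.degree g) 1 := by
        rw [MonomialOrder.leadingTerm, C_mul_monomial, mul_one]
      rw [this]
      exact Ideal.mul_mem_left _ _ (Ideal.subset_span ⟨_, ⟨g, hg, hg0, rfl⟩, rfl⟩)
  rw [mem_ideal_span_monomial_image] at hmem
  obtain ⟨_, ⟨g, hg, hg0, rfl⟩, hle⟩ := hmem (ord.degree p) (by
    rw [MonomialOrder.leadingTerm, mem_support_iff, coeff_monomial, if_pos rfl]
    exact ord.leadingCoeff_ne_zero_iff.mpr hp0)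
  exact ⟨g, hg, hg0, hle⟩

variable {M : Type*} [AddCommMonoid M] {w : σ → M}

theorem exists_monic_of_mem_initialExponents
    (hP : ∀ p ∈ P, ∀ β, weightedHomogeneousComponent w β p ∈ P) {s : σ →₀ ℕ}
    (hs : s ∈ initialExponents ord P) :
    ∃ h ∈ restrictSupport K
        {t | Finsupp.weight w t = Finsupp.weight w s ∧ ord.toSyn t < ord.toSyn s},
      monomial s 1 + h ∈ P := by
  classical
  obtain ⟨p, hp, hp0, rfl⟩ := hs
  have hlc : ord.leadingCoeff p ≠ 0 := ord.leadingCoeff_ne_zero_iff.mpr hp0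
  set q := weightedHomogeneousComponent w (Finsupp.weight w (ord.degree p)) p with hq
  refine ⟨C (ord.leadingCoeff p)⁻¹ * q - monomial (ord.degree p) 1, ?_, ?_⟩
  · rw [mem_restrictSupport_iff]
    intro t ht
    rw [Finset.mem_coe, mem_support_iff, coeff_sub, coeff_C_mul,
      coeff_weightedHomogeneousComponent, coeff_monomial] at ht
    have hne : ord.degree p ≠ t := by
      rintro rfl
      rw [if_pos rfl, if_pos rfl] at ht
      exact ht (by rw [← MonomialOrder.leadingCoeff, inv_mul_cancel₀ hlc, sub_self])
    rw [if_neg hne, sub_zero] at ht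
    by_cases hw : Finsupp.weight w t = Finsupp.weight w (ord.degree p)
    · rw [if_pos hw] at ht
      refine ⟨hw, lt_of_le_of_ne (ord.le_degree (mem_support_iff.mpr (right_ne_zero_of_mul ht))) ?_⟩
      exact fun h => hne (ord.toSyn.injective h.symm)
    · simp [hw] at ht
  · rw [add_sub_cancel]
    exact P.mul_mem_left _ (hP p hp _)

/-- Normal forms: modulo an ideal `P` that is homogeneous for the weight `w`, every monomial is
congruent to a combination of smaller standard monomials of the same weight. -/
theorem restrictSupport_le_sup (hP : ∀ p ∈ P, ∀ β, weightedHomogeneousComponent w β p ∈ P)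
    {A : Set (σ →₀ ℕ)} (hA : ∀ s ∈ A, ∀ t, Finsupp.weight w t = Finsupp.weight w s →
      ord.toSyn t < ord.toSyn s → t ∈ A) :
    restrictSupport K A ≤
      P.restrictScalars K ⊔ restrictSupport K (A ∩ (initialExponents ord P)ᶜ) := by
  have key : ∀ b : ord.syn, ∀ s ∈ A, ord.toSyn s = b → monomial s (1 : K) ∈
      P.restrictScalars K ⊔ restrictSupport K (A ∩ (initialExponents ord P)ᶜ) := by
    intro b
    induction b using WellFoundedLT.induction with
    | ind b ih =>
    rintro s hs rfl
    by_cases hin : s ∈ initialExponents ord P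
    · obtain ⟨h, hh, hmem⟩ := exists_monic_of_mem_initialExponents hP hin
      rw [← add_sub_cancel_right (monomial s (1 : K)) h]
      refine sub_mem (Submodule.mem_sup_left hmem) ?_
      rw [restrictSupport_eq_span] at hh
      refine (Submodule.span_le.mpr ?_) hh
      rintro _ ⟨t, ⟨htw, hts⟩, rfl⟩
      exact ih _ hts t (hA s hs t htw hts) rfl
    · refine Submodule.mem_sup_right ?_
      rw [restrictSupport_eq_span]
      exact Submodule.subset_span ⟨s, ⟨hs, hin⟩, rfl⟩
  rw [restrictSupport_eq_span, Submodule.span_le]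
  rintro _ ⟨s, hs, rfl⟩
  exact key _ s hs rfl

/-- Every leading exponent `s` of `P` is that of a monic element of `P` that is homogeneous for `w`
and whose other monomials are standard. -/
theorem exists_reduced_of_mem_initialExponents
    (hP : ∀ p ∈ P, ∀ β, weightedHomogeneousComponent w β p ∈ P) {s : σ →₀ ℕ}
    (hs : s ∈ initialExponents ord P) :
    ∃ h ∈ restrictSupport K
        ({t | Finsupp.weight w t = Finsupp.weight w s ∧ ord.toSyn t < ord.toSyn s} ∩
          (initialExponents ord P)ᶜ),
      monomial s 1 + h ∈ P := by
  obtain ⟨h, hh, hmem⟩ := exists_monic_of_mem_initialExponents hP hs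
  obtain ⟨p, hp, q, hq, rfl⟩ := Submodule.mem_sup.mp (restrictSupport_le_sup hP
    (fun _ hs' _ htw hts => And.intro (htw.trans hs'.1) (hts.trans hs'.2)) hh)
  refine ⟨q, hq, ?_⟩
  have := P.sub_mem hmem (show p ∈ P from hp)
  rwa [add_sub_assoc, add_sub_cancel_left] at this

end Standard

/-! ### The Rees ideal in a fixed degree -/

section Rees

open MvPolynomial

variable {K : Type*} [Field K] {n m d : ℕ}

/-- The exponent of the monomial `x^u y^a`. -/
noncomputable def joinExp (u : Fin n →₀ ℕ) (a : Fin m →₀ ℕ) : Fin n ⊕ Fin m →₀ ℕ :=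
  Finsupp.sumFinsuppAddEquivProdFinsupp.symm (u, a)

@[simp]
theorem joinExp_inl (u : Fin n →₀ ℕ) (a : Fin m →₀ ℕ) (i : Fin n) :
    joinExp u a (Sum.inl i) = u i := rfl

@[simp]
theorem joinExp_inr (u : Fin n →₀ ℕ) (a : Fin m →₀ ℕ) (j : Fin m) :
    joinExp u a (Sum.inr j) = a j := rfl

theorem exists_joinExp (s : Fin n ⊕ Fin m →₀ ℕ) : ∃ u a, s = joinExp u a :=
  ⟨_, _, (Finsupp.sumFinsuppAddEquivProdFinsupp.symm_apply_apply s).symm⟩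

theorem joinExp_inj {u v : Fin n →₀ ℕ} {a b : Fin m →₀ ℕ} (h : joinExp u a = joinExp v b) :
    u = v ∧ a = b :=
  Prod.ext_iff.mp (Finsupp.sumFinsuppAddEquivProdFinsupp.symm.injective h)

theorem joinExp_add (u v : Fin n →₀ ℕ) (a b : Fin m →₀ ℕ) :
    joinExp (u + v) (a + b) = joinExp u a + joinExp v b :=
  map_add Finsupp.sumFinsuppAddEquivProdFinsupp.symm (u, a) (v, b)

theorem joinExp_le {u v : Fin n →₀ ℕ} {a b : Fin m →₀ ℕ} :
    joinExp u a ≤ joinExp v b ↔ u ≤ v ∧ a ≤ b := by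
  simp [Finsupp.le_def]

/-- The weights of the bigrading of `K[x, y]` in which `x_i` has bidegree `(1, 0)` and `y_j` has
bidegree `(0, 1)`. -/
def bigrading (n m : ℕ) : Fin n ⊕ Fin m → ℕ × ℕ :=
  Sum.elim (fun _ => (1, 0)) fun _ => (0, 1)

theorem weight_joinExp (u : Fin n →₀ ℕ) (a : Fin m →₀ ℕ) :
    Finsupp.weight (bigrading n m) (joinExp u a) = (u.degree, a.degree) := by
  rw [Finsupp.weight_eq_sum, Fintype.sum_sum_type]
  simp [bigrading, Finsupp.degree_eq_sum, Prod.ext_iff, Prod.fst_sum, Prod.snd_sum]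

variable {I : Ideal (MvPolynomial (Fin n) K)} (f : Fin m → I)

/-- The product `f^a` of powers of the generators. -/
noncomputable def genPow (a : Fin m →₀ ℕ) : MvPolynomial (Fin n) K :=
  ∏ j, (f j : MvPolynomial (Fin n) K) ^ a j

theorem reesMap_monomial (u : Fin n →₀ ℕ) (a : Fin m →₀ ℕ) (c : K) :
    (reesMap I f (monomial (joinExp u a) c) : Polynomial (MvPolynomial (Fin n) K)) =
      Polynomial.monomial a.degree (monomial u c * genPow f a) := by
  have hx : ∏ i, (Polynomial.C (X i : MvPolynomial (Fin n) K)) ^ u i =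
      Polynomial.C (monomial u 1) := by
    rw [← Finset.prod_congr rfl (fun i _ => map_pow Polynomial.C (X i : MvPolynomial (Fin n) K) _),
      ← map_prod]
    rw [monomial_eq, map_one, one_mul, Finsupp.prod_fintype _ _ (fun _ => pow_zero _)]
  have hy : ∏ j, (Polynomial.monomial 1 (f j : MvPolynomial (Fin n) K)) ^ a j =
      Polynomial.monomial a.degree (genPow f a) := by
    simp_rw [← Polynomial.C_mul_X_pow_eq_monomial, mul_pow, Finset.prod_mul_distrib, ← map_pow,
      ← map_prod, genPow, pow_one, Finsupp.degree_eq_sum, Finset.prod_pow_eq_pow_sum]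
  rw [reesMap, aeval_monomial, Finsupp.prod_fintype _ _ (fun _ => pow_zero _),
    Fintype.prod_sum_type]
  simp only [Sum.elim_inl, Sum.elim_inr, joinExp_inl, joinExp_inr]
  have hval : ∀ z : reesAlgebra I, (z : Polynomial (MvPolynomial (Fin n) K)) =
      (reesAlgebra I).val z := fun _ => rfl
  rw [hval]
  simp only [map_mul, map_prod, map_pow, Subalgebra.coe_val]
  have hc : ((algebraMap K (reesAlgebra I) c : reesAlgebra I) :
      Polynomial (MvPolynomial (Fin n) K)) = Polynomial.C (C c) := rfl
  have hX : ∀ i, ((algebraMap (MvPolynomial (Fin n) K) (reesAlgebra I) (X i) : reesAlgebra I) :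
      Polynomial (MvPolynomial (Fin n) K)) = Polynomial.C (X i) := fun i => rfl
  simp_rw [hc, hX, hx, hy]
  rw [← mul_assoc, ← Polynomial.C_mul, C_mul_monomial, mul_one, Polynomial.C_mul_monomial]

theorem genPow_mem (a : Fin m →₀ ℕ) : genPow f a ∈ I ^ a.degree := by
  have h := (reesMap I f (monomial (joinExp 0 a) 1)).2 a.degree
  rw [reesMap_monomial, Polynomial.coeff_monomial_same] at h
  simpa using h

theorem genPow_isHomogeneous
    (hf : ∀ j, (f j : MvPolynomial (Fin n) K).IsHomogeneous d) (a : Fin m →₀ ℕ) :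
    (genPow f a).IsHomogeneous (a.degree * d) := by
  rw [Finsupp.degree_eq_sum, Finset.sum_mul]
  refine IsHomogeneous.prod _ _ _ fun j _ => ?_
  rw [mul_comm]
  exact (hf j).pow _

theorem mem_reesIdeal {p : MvPolynomial (Fin n ⊕ Fin m) K} :
    p ∈ reesIdeal I f ↔ (reesMap I f p : Polynomial (MvPolynomial (Fin n) K)) = 0 := by
  rw [reesIdeal, RingHom.mem_ker]
  exact Subtype.ext_iff

/-- The Rees ideal is bihomogeneous, because the generators `f_j` have the same degree. -/
theorem weightedHomogeneousComponent_mem_reesIdeal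
    (hf : ∀ j, (f j : MvPolynomial (Fin n) K).IsHomogeneous d)
    {p : MvPolynomial (Fin n ⊕ Fin m) K} (hp : p ∈ reesIdeal I f) (β : ℕ × ℕ) :
    weightedHomogeneousComponent (bigrading n m) β p ∈ reesIdeal I f := by
  have key : ∀ p : MvPolynomial (Fin n ⊕ Fin m) K,
      (reesMap I f (weightedHomogeneousComponent (bigrading n m) β p) :
        Polynomial (MvPolynomial (Fin n) K)) =
      Polynomial.monomial β.2 (homogeneousComponent (β.1 + β.2 * d)
        ((reesMap I f p : Polynomial (MvPolynomial (Fin n) K)).coeff β.2)) := by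
    intro p
    induction p using MvPolynomial.induction_on' with
    | monomial s c =>
      obtain ⟨u, a, rfl⟩ := exists_joinExp s
      rw [weightedHomogeneousComponent_of_mem (n := (u.degree, a.degree))
        (isWeightedHomogeneous_monomial _ _ _ (weight_joinExp u a)), reesMap_monomial,
        Polynomial.coeff_monomial]
      by_cases h2 : a.degree = β.2
      · rw [if_pos h2, homogeneousComponent_of_mem (n := u.degree + a.degree * d)
          ((isHomogeneous_monomial c rfl).mul (genPow_isHomogeneous f hf a)), ← h2]
        by_cases h1 : u.degree = β.1
        · rw [if_pos (Prod.ext h1.symm h2.symm), if_pos (by rw [h1]), reesMap_monomial]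
        · rw [if_neg (fun h => h1 (Prod.ext_iff.mp h).1.symm), if_neg (by omega)]
          simp
      · rw [if_neg h2, if_neg (fun h => h2 (Prod.ext_iff.mp h).2.symm)]
        simp
    | add p q hp hq => simp [hp, hq]
  rw [mem_reesIdeal] at hp ⊢
  rw [key, hp]
  simp

end Rees

/-! ### The strands of the Rees ideal -/

section Strand

open MvPolynomial

variable {K : Type*} [Field K] {n m d r : ℕ}

theorem linearMap_ext_monoVec {ι M : Type*} [Fintype ι] [DecidableEq ι] [AddCommMonoid M]
    [Module K M] {φ ψ : (ι → MvPolynomial (Fin n) K) →ₗ[K] M}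
    (h : ∀ a u, φ (monoVec a u) = ψ (monoVec a u)) : φ = ψ := by
  refine LinearMap.ext fun v => ?_
  rw [eq_sum_monoVec v]
  simp only [map_sum, map_smul, h]

/-- For exponents `α c` in the variables `y`, the map `⨁ S e_c → K[x, y]`, `e_c ↦ y^{α c}`. -/
noncomputable def strandMap (K : Type*) [Field K] (α : Fin r → Fin m →₀ ℕ) :
    (Fin r → MvPolynomial (Fin n) K) →ₗ[K] MvPolynomial (Fin n ⊕ Fin m) K :=
  ∑ c, ((LinearMap.mulRight K (monomial (joinExp 0 (α c)) 1)).comp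
    (rename (R := K) (Sum.inl : Fin n → Fin n ⊕ Fin m)).toLinearMap).comp (LinearMap.proj c)

theorem mapDomain_inl (u : Fin n →₀ ℕ) :
    u.mapDomain (Sum.inl : Fin n → Fin n ⊕ Fin m) = joinExp u 0 := by
  ext (i | j)
  · rw [Finsupp.mapDomain_apply Sum.inl_injective, joinExp_inl]
  · rw [Finsupp.mapDomain_of_notMem_range _ _ (by simp), joinExp_inr, Finsupp.zero_apply]

theorem strandMap_monoVec (α : Fin r → Fin m →₀ ℕ) (c : Fin r) (u : Fin n →₀ ℕ) :
    strandMap K α (monoVec c u) = monomial (joinExp u (α c)) 1 := by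
  rw [strandMap, LinearMap.sum_apply, Finset.sum_eq_single c]
  · simp [monoVec, rename_monomial, mapDomain_inl, monomial_mul, ← joinExp_add]
  · intro b _ hb
    simp [monoVec, Pi.single_eq_of_ne hb]
  · intro h
    exact absurd (Finset.mem_univ c) h

theorem coeff_strandMap {α : Fin r → Fin m →₀ ℕ} (hα : Function.Injective α)
    (v : Fin r → MvPolynomial (Fin n) K) (c : Fin r) (u : Fin n →₀ ℕ) :
    coeff (joinExp u (α c)) (strandMap K α v) = coeff u (v c) := by
  classical
  have : (lcoeff K (joinExp u (α c))).comp (strandMap K α) =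
      (lcoeff K u).comp (LinearMap.proj c) := by
    refine linearMap_ext_monoVec fun b w => ?_
    simp only [LinearMap.comp_apply, lcoeff_apply, strandMap_monoVec, LinearMap.proj_apply,
      coeff_monoVec, coeff_monomial]
    refine if_congr ⟨fun h => ?_, ?_⟩ rfl rfl
    · obtain ⟨h1, h2⟩ := joinExp_inj h
      exact ⟨hα h2, h1⟩
    · rintro ⟨rfl, rfl⟩; rfl
  exact LinearMap.congr_fun this v

variable {I : Ideal (MvPolynomial (Fin n) K)} (f : Fin m → I)

/-- Under the identification of `⨁ S e_c` with a part of the strand of `y`-degree `k` of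
`K[x, y]`, the Rees ideal restricts to the relations between the products `f^{α c}`. -/
theorem strandMap_mem_reesIdeal_iff {k : ℕ} {α : Fin r → Fin m →₀ ℕ} (hk : ∀ c, (α c).degree = k)
    (v : Fin r → MvPolynomial (Fin n) K) :
    strandMap K α v ∈ reesIdeal I f ↔
      Fintype.linearCombination (MvPolynomial (Fin n) K) (fun c => genPow f (α c)) v = 0 := by
  have : (((reesAlgebra I).val.restrictScalars K).comp (reesMap I f)).toLinearMap.comp
      (strandMap K α) =
      ((Polynomial.monomial k).restrictScalars K).comp ((Fintype.linearCombination
        (MvPolynomial (Fin n) K) (fun c => genPow f (α c))).restrictScalars K) := by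
    refine linearMap_ext_monoVec fun c u => ?_
    simp only [LinearMap.comp_apply, strandMap_monoVec]
    refine (reesMap_monomial f u (α c) 1).trans ?_
    rw [hk]
    simp [monoVec, Fintype.linearCombination_apply_single]
  have hv : (reesMap I f (strandMap K α v) : Polynomial (MvPolynomial (Fin n) K)) =
      Polynomial.monomial k (Fintype.linearCombination (MvPolynomial (Fin n) K)
        (fun c => genPow f (α c)) v) := LinearMap.congr_fun this v
  rw [mem_reesIdeal, hv, Polynomial.monomial_eq_zero_iff]

variable {f}

/-- Standard monomials in the `y` alone suffice to generate the powers of `I`. -/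
theorem span_genPow_eq_pow {ord : MonomialOrder (Fin n ⊕ Fin m)}
    (hf : ∀ j, (f j : MvPolynomial (Fin n) K).IsHomogeneous d)
    (hI : Ideal.span (Set.range fun j => (f j : MvPolynomial (Fin n) K)) = I) {k : ℕ}
    {α : Fin r → Fin m →₀ ℕ} (hk : ∀ c, (α c).degree = k)
    (hα : ∀ a : Fin m →₀ ℕ, a.degree = k →
      joinExp 0 a ∉ initialExponents ord (reesIdeal I f) → ∃ c, α c = a) :
    Ideal.span (Set.range fun c => genPow f (α c)) = I ^ k := by
  apply le_antisymm
  · rw [Ideal.span_le]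
    rintro _ ⟨c, rfl⟩
    exact hk c ▸ genPow_mem f (α c)
  · intro x hx
    obtain ⟨t, ht⟩ := reesMap_surjective I f hI ⟨Polynomial.monomial k x,
      reesAlgebra.monomial_mem.mpr hx⟩
    obtain ⟨p, hp, q, hq, rfl⟩ := Submodule.mem_sup.mp
      (restrictSupport_le_sup (ord := ord) (w := bigrading n m) (A := Set.univ)
        (fun _ hp β => weightedHomogeneousComponent_mem_reesIdeal f hf hp β)
        (fun _ _ _ _ _ => Set.mem_univ _) (show t ∈ restrictSupport K Set.univ by simp))
    have hqx : ((reesMap I f q : Polynomial (MvPolynomial (Fin n) K))).coeff k = x := by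
      rw [map_add, show reesMap I f p = 0 from hp, zero_add] at ht
      rw [ht, Polynomial.coeff_monomial_same]
    rw [← hqx]
    rw [Set.univ_inter, restrictSupport_eq_span] at hq
    clear hqx ht
    induction hq using Submodule.span_induction with
    | mem y hy =>
      obtain ⟨s, hs, rfl⟩ := hy
      obtain ⟨u, a, rfl⟩ := exists_joinExp s
      simp only []
      rw [reesMap_monomial, Polynomial.coeff_monomial]
      split_ifs with hak
      · obtain ⟨c, rfl⟩ := hα a hak fun h =>
          hs (initialExponents_of_le h (joinExp_le.mpr ⟨zero_le, le_rfl⟩))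
        exact Ideal.mul_mem_left _ _ (Ideal.subset_span ⟨c, rfl⟩)
      · exact zero_mem _
    | zero => simp
    | add y z _ _ hy hz =>
      rw [map_add]
      exact add_mem hy hz
    | smul c y _ hy =>
      rw [map_smul]
      have : (((c • reesMap I f y : reesAlgebra I) :
          Polynomial (MvPolynomial (Fin n) K))).coeff k =
          C c * (reesMap I f y : Polynomial (MvPolynomial (Fin n) K)).coeff k := by
        rw [← smul_eq_C_mul, ← Polynomial.coeff_smul]
        rfl
      rw [this]
      exact Ideal.mul_mem_left _ _ hy

/-- If the Rees ideal has a Gröbner basis of `x`-degree at most one, then the relations between the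
products `f^a`, for the standard monomials `y^a` of degree `k`, have a linear Gröbner basis: the
initial ideal in the component `S y^a` is generated by variables. -/
theorem isLinearGroebner_ker {ord : MonomialOrder (Fin n ⊕ Fin m)}
    (hf : ∀ j, (f j : MvPolynomial (Fin n) K).IsHomogeneous d)
    {G : Set (MvPolynomial (Fin n ⊕ Fin m) K)} (hG : IsGroebnerBasis ord (reesIdeal I f) G)
    (hx : ∀ g ∈ G, xDegree g ≤ 1) {k : ℕ} {α : Fin r → Fin m →₀ ℕ} (hinj : Function.Injective α)
    (hk : ∀ c, (α c).degree = k)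
    (hstd : ∀ c, joinExp 0 (α c) ∉ initialExponents ord (reesIdeal I f))
    (hα : ∀ a : Fin m →₀ ℕ, a.degree = k →
      joinExp 0 a ∉ initialExponents ord (reesIdeal I f) → ∃ c, α c = a) :
    IsLinearGroebner (fun c u => ord.toSyn (joinExp u (α c)))
      (fun c => {i | joinExp (Finsupp.single i 1) (α c) ∈ initialExponents ord (reesIdeal I f)})
      (LinearMap.ker (Fintype.linearCombination (MvPolynomial (Fin n) K)
        fun c => genPow f (α c))) := by
  have hP : ∀ p ∈ reesIdeal I f, ∀ β,
      weightedHomogeneousComponent (bigrading n m) β p ∈ reesIdeal I f :=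
    fun _ hp β => weightedHomogeneousComponent_mem_reesIdeal f hf hp β
  refine ⟨?_, ?_, ?_, ?_⟩
  · intro a b u v h
    obtain ⟨h1, h2⟩ := joinExp_inj (ord.toSyn.injective h)
    exact ⟨hinj h2, h1⟩
  · intro a b u v w h
    have hadd : ∀ (c : Fin r) (z : Fin n →₀ ℕ),
        joinExp (z + w) (α c) = joinExp z (α c) + joinExp w 0 := by
      intro c z
      rw [← joinExp_add, add_zero]
    simp only [hadd, map_add]
    exact add_lt_add_left h _
  · intro c i hi
    obtain ⟨h, hh, hmem⟩ := exists_reduced_of_mem_initialExponents hP hi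
    have hmap : h ∈ (monoSpan K (fun c u => ord.toSyn (joinExp u (α c))) 1
        (Set.Iio (ord.toSyn (joinExp (Finsupp.single i 1) (α c))))).map (strandMap K α) := by
      rw [restrictSupport_eq_span] at hh
      refine (Submodule.span_le.mpr ?_) hh
      rintro _ ⟨t, ⟨⟨htw, hts⟩, htstd⟩, rfl⟩
      obtain ⟨u, a, rfl⟩ := exists_joinExp t
      rw [weight_joinExp, weight_joinExp, Finsupp.degree_single, hk] at htw
      obtain ⟨hu, ha⟩ := Prod.ext_iff.mp htw
      -- Divisors of standard monomials are standard.
      obtain ⟨b, rfl⟩ := hα a ha fun h =>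
        htstd (initialExponents_of_le h (joinExp_le.mpr ⟨zero_le, le_rfl⟩))
      exact ⟨monoVec b u, Submodule.subset_span ⟨b, u, hu, hts, rfl⟩, strandMap_monoVec α b u⟩
    obtain ⟨v, hv, rfl⟩ := hmap
    refine ⟨v, hv, ?_⟩
    rw [LinearMap.mem_ker, ← strandMap_mem_reesIdeal_iff f hk, map_add, strandMap_monoVec]
    exact hmem
  · intro v hv hvstd
    rw [LinearMap.mem_ker, ← strandMap_mem_reesIdeal_iff f hk] at hv
    have hmem : strandMap K α v ∈
        restrictSupport K (initialExponents ord (reesIdeal I f))ᶜ := by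
      rw [eq_sum_monoVec v]
      simp_rw [map_sum, map_smul, strandMap_monoVec]
      refine sum_mem fun c _ => sum_mem fun u hu => Submodule.smul_mem _ _ ?_
      rw [restrictSupport_eq_span]
      refine Submodule.subset_span ⟨_, fun hin => mem_support_iff.mp hu ?_, rfl⟩
      obtain ⟨g, hgG, hg0, hle⟩ := hG.exists_degree_le hin
      have hgin : ord.degree g ∈ initialExponents ord (reesIdeal I f) :=
        ⟨g, hG.2.1 hgG, hg0, rfl⟩
      obtain ⟨u', a', hga⟩ := exists_joinExp (ord.degree g)
      have hdeg : u'.degree ≤ 1 := by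
        refine le_trans ?_ (hx g hgG)
        rw [xDegree]
        refine le_trans (le_of_eq ?_) (Finset.le_sup (ord.degree_mem_support hg0))
        rw [hga, Finsupp.degree_eq_sum]
        rfl
      rw [hga] at hgin hle
      obtain ⟨hu', ha'⟩ := joinExp_le.mp hle
      by_cases h0 : u' = 0
      · subst h0
        exact absurd (initialExponents_of_le hgin (joinExp_le.mpr ⟨le_rfl, ha'⟩)) (hstd c)
      · obtain ⟨i, hi⟩ := Finsupp.ne_iff.mp h0
        rw [Finsupp.zero_apply] at hi
        have hsingle : u' = Finsupp.single i 1 := by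
          have hle1 : Finsupp.single i 1 ≤ u' :=
            Finsupp.single_le_iff.mpr (Nat.one_le_iff_ne_zero.mpr hi)
          have hd := congrArg Finsupp.degree (add_tsub_cancel_of_le hle1)
          rw [map_add, Finsupp.degree_single] at hd
          have hz : u' - Finsupp.single i 1 = 0 := by
            rw [← Finsupp.degree_eq_zero_iff]; omega
          exact le_antisymm (tsub_eq_zero_iff_le.mp hz) hle1
        subst hsingle
        refine hvstd c u ⟨i, initialExponents_of_le hgin (joinExp_le.mpr ⟨le_rfl, ha'⟩), ?_⟩
        exact Nat.one_le_iff_ne_zero.mp (Finsupp.single_le_iff.mp hu')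
    have hzero := eq_zero_of_mem_restrictSupport_compl hv hmem
    ext c u
    rw [← coeff_strandMap hinj, hzero]
    simp

end Strand

theorem corollary1p2 {K : Type*} [Field K] {n m d : ℕ}
    (I : Ideal (MvPolynomial (Fin n) K)) (f : Fin m → I)
    (hf : ∀ j, (f j : MvPolynomial (Fin n) K).IsHomogeneous d)
    (hI : Ideal.span (Set.range fun j => (f j : MvPolynomial (Fin n) K)) = I)
    (h : ∃ (ord : MonomialOrder (Fin n ⊕ Fin m)) (G : Set (MvPolynomial (Fin n ⊕ Fin m) K)),
      IsGroebnerBasis ord (reesIdeal I f) G ∧ ∀ g ∈ G, xDegree g ≤ 1)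
    (k : ℕ) : HasLinearResolution (I ^ k) (k * d) := by
  obtain ⟨ord, G, hG, hx⟩ := h
  have hfin : Finite {a : Fin m →₀ ℕ // a.degree = k ∧
      joinExp 0 a ∉ initialExponents ord (reesIdeal I f)} :=
    Set.Finite.subset (Finsupp.finite_of_degree_eq k) fun _ ha => ha.1
  obtain ⟨r, ⟨q⟩⟩ := Finite.exists_equiv_fin {a : Fin m →₀ ℕ // a.degree = k ∧
      joinExp 0 a ∉ initialExponents ord (reesIdeal I f)}
  have hk : ∀ c, (q.symm c).1.degree = k := fun c => (q.symm c).2.1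
  have hα : ∀ a : Fin m →₀ ℕ, a.degree = k →
      joinExp 0 a ∉ initialExponents ord (reesIdeal I f) → ∃ c, (q.symm c).1 = a :=
    fun a ha hin => ⟨q ⟨a, ha, hin⟩, by simp⟩
  refine hasLinearResolution_of_hasLinearGroebner (fun c => genPow f (q.symm c).1)
    (fun c => ?_) (span_genPow_eq_pow hf hI hk hα)
    ⟨ord.syn, inferInstance, inferInstance, _, _, isLinearGroebner_ker hf hG hx
      (Subtype.val_injective.comp q.symm.injective) hk (fun c => (q.symm c).2.2) hα⟩
  have := genPow_isHomogeneous f hf (q.symm c).1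
  rwa [hk] at this
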